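/- Let $\mu$ be the Borel measure on $\mathbb{R}$ given by $\mu(B)=\frac{1}{2\pi}\int_B\frac{dy}{\frac14+y^2}$. For $\frac12<\sigma<1$ and $n\ge 1$ put $$\bar a_n=\frac{1}{n!}\sum_{k=1}^{n}\binom{n}{k}\frac{(-1)^{n-k}(n-1)!}{(k-1)!}\left.\frac{\partial^{k}}{\partial s^{k}}\frac{1}{\zeta(\sigma+\frac12-s)}\right|_{s=0}.$$ Assume the Riemann Hypothesis. Then, for every $\sigma$ with $\frac12<\sigma<1$, the function $y\mapsto 1/\zeta(\sigma+iy)$ belongs to $L^2(\mu)$; the $\bar a_n$ are its Fourier coefficients $$\bar a_n=\int_{\mathbb{R}}\frac{e^{2in\tan^{-1}(2y)}}{\zeta(\sigma+iy)}\,d\mu(y)\qquad(n\ge1);$$ the series $\sum_{k\ge1}|\bar a_k|^2$ converges; and $$\int_{\mathbb{R}}\frac{d\mu(y)}{|\zeta(\sigma+iy)|^2}=\frac{1}{\zeta^2(\sigma+\frac12)}+\sum_{k\ge1}|\bar a_k|^2 .$$ -/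

import Mathlib

open MeasureTheory

noncomputable section

/-- The measure `μ(B) = (1 / 2π) ∫_B dy / (1/4 + y²)` on the Borel sets of `ℝ`. -/
def muMeasure : Measure ℝ :=
  volume.withDensity fun y : ℝ => ENNReal.ofReal (1 / (2 * Real.pi) * (1 / (1 / 4 + y ^ 2)))

/-- The function `y ↦ 1 / ζ(σ + i y)` on the real line. -/
def recipZeta (σ : ℝ) (y : ℝ) : ℂ :=
  1 / riemannZeta ((σ : ℂ) + Complex.I * (y : ℂ))

/-- The `n`-th Fourier coefficient `∫ f(y) e^{2 i n arctan(2y)} dμ(y)` of `f` with respect to the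
system `e^{-2 i n arctan(2y)}`, `n ∈ ℤ`, in `L²(μ)`. -/
def fourierCoeffMu (f : ℝ → ℂ) (n : ℤ) : ℂ :=
  ∫ y : ℝ, f y * Complex.exp (2 * Complex.I * (n : ℂ) * (Real.arctan (2 * y) : ℂ)) ∂muMeasure

/-- The coefficients, for `n ≥ 1`,
`ā_n = (1/n!) ∑_{k=1}^{n} C(n,k) (-1)^{n-k} (n-1)!/(k-1)! (d/ds)^k [1/ζ(σ + 1/2 - s)]_{s=0}`. -/
def abar (σ : ℝ) (n : ℕ) : ℂ :=
  1 / (n.factorial : ℂ) *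
    ∑ k ∈ Finset.Icc 1 n,
      (n.choose k : ℂ) * ((-1 : ℂ) ^ (n - k) * ((n - 1).factorial : ℂ) / ((k - 1).factorial : ℂ)) *
        iteratedDeriv k (fun s : ℂ => 1 / riemannZeta ((σ : ℂ) + 1 / 2 - s)) 0

end

/-! The Cayley transform turns the statement into Parseval's identity for a holomorphic function on
the unit disc. The point `u = e^{-2i arctan(2y)}` satisfies `1/(1+u) = 1/2 + iy`, and `μ` is the
pullback of normalized Haar measure on the circle (`measurePreserving_cayleyAngle`). Hence
`1/ζ(σ+iy)` is the boundary value of `H(u) = (1/ζ)(σ - 1/2 + 1/(1+u))`. The map `1/(1+u)` sends the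
disc into `re > 1/2`, so under RH `H` is holomorphic there.

If `H` has an L² majorant along radii, the Fourier coefficients of its boundary function are its
Taylor coefficients at 0, and those of negative index vanish (`fourierCoeff_boundary`). Parseval
then gives the identity, with constant term `H(0) = 1/ζ(σ+1/2)`. The chain rule for `s = u/(1+u)`,
in which Lah numbers appear, identifies the other Taylor coefficients with `ā_n` (`abar_eq`).

The majorant is the analytic input. Littlewood's bound `1/ζ = O(|t|^ε)` becomes `|H(u)| ≤ C
|1+u|^{-ε}`, square integrable for `ε = 1/4`. To prove it, take a branch of `log ζ` on a disc about
`2+it`. Polynomial growth of `ζ` and Borel–Carathéodory give `O(log|t|)` on a large circle, while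
Dirichlet series give `O(1)` on a small one. The three circles theorem yields `O((log|t|)^θ)` with
`θ < 1` in between, which is at most `ε log|t| + O(1)`. -/

/-- The function `t ↦ {t}` restricted to `(1, ∞)`, whose Mellin transform continues `ζ`. -/
noncomputable def fractTail : ℝ → ℂ := (Set.Ioi (1 : ℝ)).indicator fun t => ((Int.fract t : ℝ) : ℂ)

/-! ### Linear growth of `ζ` in the half-plane `re s > 0` -/

section ZetaBound
open Set Filter Topology Complex

lemma norm_fractTail_le (t : ℝ) : ‖fractTail t‖ ≤ 1 := by
  unfold fractTail
  refine (norm_indicator_le_norm_self _ _).trans ?_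
  rw [Complex.norm_real, Real.norm_eq_abs, abs_of_nonneg (Int.fract_nonneg t)]
  exact (Int.fract_lt_one t).le

lemma measurable_fractTail : Measurable fractTail :=
  (Complex.measurable_ofReal.comp measurable_fract).indicator measurableSet_Ioi

lemma differentiableAt_mellin_fractTail {s : ℂ} (hs : s.re < 0) :
    DifferentiableAt ℂ (mellin fractTail) s := by
  -- Boundedness at infinity gives `a = 0`; vanishing near 0 allows any exponent `b` below `s.re`.
  refine mellin_differentiableAt_of_isBigO_rpow (a := 0) (b := s.re - 1) ?_ ?_ hs ?_ (by linarith)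
  · refine LocallyIntegrable.locallyIntegrableOn ?_ _
    refine (locallyIntegrable_const (1 : ℝ)).mono measurable_fractTail.aestronglyMeasurable
      (.of_forall fun t => ?_)
    simpa using norm_fractTail_le t
  · refine Asymptotics.IsBigO.of_bound 1 (.of_forall fun t => ?_)
    simpa using norm_fractTail_le t
  · refine (Asymptotics.isBigO_zero _ _).congr' ?_ EventuallyEq.rfl
    filter_upwards [Ioo_mem_nhdsGT (zero_lt_one (α := ℝ))] with t ht
    simp [fractTail, ht.2.le]

lemma mellin_fractTail (s : ℂ) :
    mellin fractTail (-s) = ∫ t in Ioi (1 : ℝ), ((Int.fract t : ℝ) : ℂ) * (t : ℂ) ^ (-(s + 1)) := by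
  have h : ∀ t : ℝ, (t : ℂ) ^ (-s - 1) • fractTail t =
      (Ioi (1 : ℝ)).indicator (fun t : ℝ => ((Int.fract t : ℝ) : ℂ) * (t : ℂ) ^ (-(s + 1))) t := by
    intro t
    by_cases ht : t ∈ Ioi (1 : ℝ)
    · simp only [fractTail, indicator_of_mem ht, smul_eq_mul]
      rw [mul_comm]; congr 2; ring
    · simp [fractTail, indicator_of_notMem ht]
  simp_rw [mellin, h]
  rw [setIntegral_indicator measurableSet_Ioi]
  congr 2
  ext t; simp

lemma norm_mellin_fractTail_le {s : ℂ} (hs : 0 < s.re) : ‖mellin fractTail (-s)‖ ≤ 1 / s.re := by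
  rw [mellin_fractTail]
  have h1 : ∫ t in Ioi (1 : ℝ), t ^ (-(s.re + 1)) = 1 / s.re := by
    rw [integral_Ioi_rpow_of_lt (by linarith) one_pos]
    simp [neg_div_neg_eq]
  rw [← h1]
  refine norm_integral_le_of_norm_le (integrableOn_Ioi_rpow_of_lt (by linarith) one_pos) ?_
  filter_upwards [ae_restrict_mem measurableSet_Ioi] with t ht
  have ht0 : (0 : ℝ) < t := one_pos.trans ht
  rw [norm_mul, Complex.norm_cpow_eq_rpow_re_of_pos ht0, Complex.norm_real, Real.norm_eq_abs,
    abs_of_nonneg (Int.fract_nonneg t)]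
  simpa using mul_le_mul_of_nonneg_right (Int.fract_lt_one t).le (Real.rpow_nonneg ht0.le _)

/-- Abel summation gives `ζ(s) = s ∫ ⌊t⌋ t^{-s-1}` over `(1, ∞)`; split `⌊t⌋ = t - {t}`. -/
lemma riemannZeta_eq_sub_mellin_fractTail {s : ℂ} (hs : 1 < s.re) :
    riemannZeta s = s / (s - 1) - s * mellin fractTail (-s) := by
  have hs1 : s - 1 ≠ 0 := fun h => by
    rw [sub_eq_zero] at h; simp [h] at hs
  have hS : LSeriesSummable 1 s := LSeriesSummable_one_iff.2 hs
  have h := LSeries_eq_mul_integral 1 zero_le_one hs hS (by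
    refine Asymptotics.IsBigO.of_bound 1 (.of_forall fun n => ?_)
    simp)
  rw [LSeries_one_eq_riemannZeta hs] at h
  rw [h, mellin_fractTail]
  have hi1 : IntegrableOn (fun t : ℝ => (t : ℂ) ^ (-s)) (Ioi 1) :=
    integrableOn_Ioi_cpow_of_lt (by simpa using hs) one_pos
  have hi2 : IntegrableOn (fun t : ℝ => ((Int.fract t : ℝ) : ℂ) * (t : ℂ) ^ (-(s + 1))) (Ioi 1) := by
    refine (integrableOn_Ioi_cpow_of_lt (a := -(s + 1)) (by simp; linarith) one_pos).bdd_mul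
      (c := 1) ?_ (.of_forall fun t => ?_)
    · exact (Complex.measurable_ofReal.comp measurable_fract).aestronglyMeasurable
    · rw [Complex.norm_real, Real.norm_eq_abs, abs_of_nonneg (Int.fract_nonneg t)]
      exact (Int.fract_lt_one t).le
  have h2 : ∫ t in Ioi (1 : ℝ), (∑ k ∈ Finset.Icc 1 ⌊t⌋₊, (1 : ℕ → ℂ) k) * (t : ℂ) ^ (-(s + 1)) =
      ∫ t in Ioi (1 : ℝ), ((t : ℂ) ^ (-s) - ((Int.fract t : ℝ) : ℂ) * (t : ℂ) ^ (-(s + 1))) := by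
    refine setIntegral_congr_fun measurableSet_Ioi fun t ht => ?_
    have ht0 : (0 : ℝ) < t := one_pos.trans ht
    have hfl : ((⌊t⌋₊ : ℝ) : ℂ) = (t : ℂ) - ((Int.fract t : ℝ) : ℂ) := by
      rw [← Complex.ofReal_sub, natCast_floor_eq_intCast_floor ht0.le, Int.self_sub_fract]
    have hpow : (t : ℂ) ^ (-s) = (t : ℂ) * (t : ℂ) ^ (-(s + 1)) := by
      rw [show -s = 1 + -(s + 1) by ring, Complex.cpow_add _ _ (by exact_mod_cast ht0.ne'),
        Complex.cpow_one]
    simp only [Pi.one_apply, Finset.sum_const, Nat.card_Icc, add_tsub_cancel_right, nsmul_eq_mul,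
      mul_one]
    rw [hpow, ← sub_mul, ← hfl]; simp
  rw [h2, integral_sub hi1 hi2, integral_Ioi_cpow_of_lt (by simpa using hs) one_pos, mul_sub]
  congr 1
  have : -s + 1 ≠ 0 := fun h => hs1 (by linear_combination -h)
  simp
  field_simp
  ring

/-- The continuation of `(s - 1) ζ(s)` to the half-plane `0 < re s`. -/
lemma riemannZeta₁_eq_sub_mellin_fractTail {s : ℂ} (hs : 0 < s.re) :
    riemannZeta₁ s = s - s * (s - 1) * mellin fractTail (-s) := by
  have hU : IsOpen {z : ℂ | 0 < z.re} := isOpen_lt continuous_const Complex.continuous_re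
  have hf : AnalyticOnNhd ℂ riemannZeta₁ {z : ℂ | 0 < z.re} :=
    differentiable_riemannZeta₁.differentiableOn.analyticOnNhd hU
  have hg : AnalyticOnNhd ℂ (fun s => s - s * (s - 1) * mellin fractTail (-s)) {z : ℂ | 0 < z.re} := by
    refine DifferentiableOn.analyticOnNhd (fun z hz => DifferentiableAt.differentiableWithinAt ?_) hU
    have h1 : DifferentiableAt ℂ (fun s => mellin fractTail (-s)) z :=
      DifferentiableAt.comp (g := mellin fractTail) z
        (differentiableAt_mellin_fractTail (by simpa using hz)) differentiable_neg.differentiableAt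
    fun_prop
  have hc : IsPreconnected {z : ℂ | 0 < z.re} :=
    (convex_halfSpace_re_gt 0).isPreconnected
  -- Identity theorem: both sides are analytic on `re > 0` and agree near 2.
  refine hf.eqOn_of_preconnected_of_eventuallyEq hg hc (z₀ := 2) (by simp) ?_ hs
  have hV : IsOpen {z : ℂ | 1 < z.re} := isOpen_lt continuous_const Complex.continuous_re
  filter_upwards [hV.mem_nhds (show (2 : ℂ) ∈ {z : ℂ | 1 < z.re} by simp)] with z hz
  have hz1 : z ≠ 1 := fun h => by simp [h] at hz
  have h := riemannZeta_eq_inv_sub_mul hz1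
  rw [riemannZeta_eq_sub_mellin_fractTail hz] at h
  have := sub_ne_zero.2 hz1
  field_simp at h
  linear_combination -h

lemma norm_riemannZeta_le {s : ℂ} (hs : 0 < s.re) (hs1 : s ≠ 1) :
    ‖riemannZeta s‖ ≤ ‖s‖ / ‖s - 1‖ + ‖s‖ / s.re := by
  have h0 := sub_ne_zero.2 hs1
  have h : riemannZeta s = s / (s - 1) - s * mellin fractTail (-s) := by
    rw [riemannZeta_eq_inv_sub_mul hs1, riemannZeta₁_eq_sub_mellin_fractTail hs]
    field_simp
  rw [h]
  refine (norm_sub_le _ _).trans ?_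
  rw [norm_div, norm_mul, div_eq_mul_one_div ‖s‖ s.re]
  gcongr
  exact norm_mellin_fractTail_le hs

end ZetaBound

/-! ### Holomorphic logarithms, three circles, an elementary inequality -/

section ComplexAnalysis
open Set Filter Topology Complex Metric

/-- A nonvanishing holomorphic function on a disc has a holomorphic logarithm whose value at the
centre is the principal one. -/
lemma exists_log_of_differentiableOn_ball {f : ℂ → ℂ} {c : ℂ} {r : ℝ} (hr : 0 < r)
    (hf : DifferentiableOn ℂ f (ball c r)) (h0 : ∀ z ∈ ball c r, f z ≠ 0) :
    ∃ g : ℂ → ℂ, g c = log (f c) ∧ (∀ z ∈ ball c r, HasDerivAt g (deriv f z / f z) z) ∧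
      ∀ z ∈ ball c r, exp (g z) = f z := by
  have hd : DifferentiableOn ℂ (fun z => deriv f z / f z) (ball c r) :=
    (hf.deriv isOpen_ball).div hf h0
  obtain ⟨g, hgc, hg⟩ := hd.isExactOn_ball.with_val_at c (log (f c))
  have hc : c ∈ ball c r := mem_ball_self hr
  refine ⟨g, hgc, hg, fun z hz => ?_⟩
  have hq : ∀ w ∈ ball c r, HasDerivAt (fun w => exp (-g w) * f w) 0 w := by
    intro w hw
    have h1 := ((hg w hw).neg.cexp).mul
      (hf.differentiableAt (isOpen_ball.mem_nhds hw)).hasDerivAt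
    refine h1.congr_deriv ?_
    linear_combination -exp (-g w) * div_mul_cancel₀ (deriv f w) (h0 w hw)
  have hconst : exp (-g z) * f z = exp (-g c) * f c :=
    (convex_ball c r).is_const_of_fderivWithin_eq_zero (𝕜 := ℂ)
      (f := fun w => exp (-g w) * f w)
      (fun w hw => (hq w hw).differentiableAt.differentiableWithinAt)
      (fun w hw => by
        rw [fderivWithin_of_isOpen isOpen_ball hw, (hq w hw).hasFDerivAt.fderiv]
        ext; simp) hz hc
  rw [hgc, Complex.exp_neg (log (f c)), Complex.exp_log (h0 c hc), inv_mul_cancel₀ (h0 c hc),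
    Complex.exp_neg, inv_mul_eq_one₀ (Complex.exp_ne_zero _)] at hconst
  exact hconst

/-- Hadamard's **three circles theorem**. -/
lemma norm_le_interp_of_mem_annulus {f : ℂ → ℂ} {c z : ℂ} {r₁ r₂ R a b : ℝ} (hr₁ : 0 < r₁)
    (hr : r₁ < r₂) (hR : r₂ < R) (hf : DifferentiableOn ℂ f (ball c R))
    (ha : ∀ w ∈ sphere c r₁, ‖f w‖ ≤ a) (hb : ∀ w ∈ sphere c r₂, ‖f w‖ ≤ b)
    (hz₁ : r₁ ≤ ‖z - c‖) (hz₂ : ‖z - c‖ ≤ r₂) :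
    ‖f z‖ ≤ a ^ (1 - (Real.log ‖z - c‖ - Real.log r₁) / (Real.log r₂ - Real.log r₁)) *
      b ^ ((Real.log ‖z - c‖ - Real.log r₁) / (Real.log r₂ - Real.log r₁)) := by
  have hr₂ : 0 < r₂ := hr₁.trans hr
  have hlog : Real.log r₁ < Real.log r₂ := Real.log_lt_log hr₁ hr
  have hcl : closedBall c r₂ ⊆ ball c R := closedBall_subset_ball hR
  have hmap : ∀ w : ℂ, w.re ≤ Real.log r₂ → c + exp w ∈ closedBall c r₂ := by
    intro w hw
    rw [mem_closedBall, dist_eq_norm, add_sub_cancel_left, Complex.norm_exp,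
      ← Real.exp_log hr₂]
    exact Real.exp_le_exp.2 hw
  have hsph : ∀ (w : ℂ) (r : ℝ), 0 < r → w.re = Real.log r → c + exp w ∈ sphere c r := by
    intro w r h0 hw
    rw [mem_sphere, dist_eq_norm, add_sub_cancel_left, Complex.norm_exp, hw, Real.exp_log h0]
  have hzc : z - c ≠ 0 := norm_pos_iff.1 (hr₁.trans_le hz₁)
  have hre : (log (z - c)).re = Real.log ‖z - c‖ := Complex.log_re _
  -- Three lines for `w ↦ f(c + e^w)`, under which vertical lines become circles about `c`.
  have key := HadamardThreeLines.norm_le_interp_of_mem_verticalClosedStrip'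
    (f := fun w => f (c + exp w)) (z := log (z - c)) (a := a) (b := b) hlog
    (by
      simp only [HadamardThreeLines.verticalClosedStrip, mem_preimage, hre, mem_Icc]
      exact ⟨Real.log_le_log hr₁ hz₁, Real.log_le_log (hr₁.trans_le hz₁) hz₂⟩)
    (by
      refine DifferentiableOn.diffContOnCl fun w hw => ?_
      have hw' : w.re ≤ Real.log r₂ := by
        have hsub : HadamardThreeLines.verticalStrip (Real.log r₁) (Real.log r₂) ⊆
            {w : ℂ | w.re ≤ Real.log r₂} := fun w hw => hw.2.le
        exact closure_minimal hsub (isClosed_le Complex.continuous_re continuous_const) hw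
      have h1 := hf.differentiableAt (isOpen_ball.mem_nhds (hcl (hmap w hw')))
      have h2 : DifferentiableAt ℂ (fun w => c + exp w) w := by fun_prop
      exact (DifferentiableAt.comp w h1 h2).differentiableWithinAt)
    (by
      obtain ⟨B, hB⟩ := (isCompact_closedBall c r₂).exists_bound_of_continuousOn
        (hf.continuousOn.mono hcl)
      refine ⟨B, ?_⟩
      rintro _ ⟨w, hw, rfl⟩
      exact hB _ (hmap w hw.2))
    (fun w hw => ha _ (hsph w r₁ hr₁ hw)) (fun w hw => hb _ (hsph w r₂ hr₂ hw))
  rw [hre] at key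
  simpa [Complex.exp_log hzc] using key

/-- For large `x` the factor in `x^θ = x^{-(1-θ)} x` is below `δ`; smaller `x` go into `C`. It
converts `(log|t|)^θ` into `ε log|t| + O(1)`. -/
lemma exists_rpow_le_mul_add {θ δ : ℝ} (hθ0 : 0 ≤ θ) (hθ : θ < 1) (hδ : 0 < δ) :
    ∃ C : ℝ, 0 ≤ C ∧ ∀ x : ℝ, 0 ≤ x → x ^ θ ≤ δ * x + C := by
  have h := (tendsto_rpow_neg_atTop (sub_pos.2 hθ)).eventually_le_const hδ
  obtain ⟨x₀, hx₀⟩ := eventually_atTop.1 (h.and (eventually_gt_atTop 0))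
  refine ⟨(max x₀ 0) ^ θ, Real.rpow_nonneg (le_max_right _ _) _, fun x hx => ?_⟩
  rcases le_total x₀ x with hxx | hxx
  · obtain ⟨h1, h2⟩ := hx₀ x hxx
    have h3 : x ^ θ = x ^ (-(1 - θ)) * x := by
      rw [← Real.rpow_add_one h2.ne']; ring_nf
    rw [h3]
    nlinarith [Real.rpow_nonneg (le_max_right x₀ 0) θ]
  · have : x ^ θ ≤ (max x₀ 0) ^ θ :=
      Real.rpow_le_rpow hx (hxx.trans (le_max_left _ _)) hθ0
    nlinarith

end ComplexAnalysis

/-! ### Uniform Dirichlet series bounds in `re s ≥ x > 1` -/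

section HalfPlaneBounds
open Complex ArithmeticFunction

lemma LSeries.norm_le_of_le_re {f : ℕ → ℂ} {x : ℝ} (hf : LSeriesSummable f x) {s : ℂ}
    (hs : x ≤ s.re) : ‖LSeries f s‖ ≤ ∑' n, ‖LSeries.term f x n‖ := by
  have hle : ∀ n, ‖LSeries.term f s n‖ ≤ ‖LSeries.term f x n‖ := fun n =>
    LSeries.norm_term_le_of_re_le_re f (by simpa using hs) n
  exact tsum_of_norm_bounded hf.norm.hasSum hle

lemma exists_norm_riemannZeta_le {x : ℝ} (hx : 1 < x) :
    ∃ C : ℝ, 0 < C ∧ ∀ s : ℂ, x ≤ s.re → ‖riemannZeta s‖ ≤ C := by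
  refine ⟨max (∑' n, ‖LSeries.term 1 x n‖) 1, lt_max_of_lt_right one_pos,
    fun s hs => le_max_of_le_left ?_⟩
  · rw [← LSeries_one_eq_riemannZeta (hx.trans_le hs)]
    exact LSeries.norm_le_of_le_re (LSeriesSummable_one_iff.2 (by simpa using hx)) hs

lemma exists_norm_riemannZeta_inv_le {x : ℝ} (hx : 1 < x) :
    ∃ C : ℝ, 0 < C ∧ ∀ s : ℂ, x ≤ s.re → ‖riemannZeta s‖⁻¹ ≤ C := by
  refine ⟨max (∑' n, ‖LSeries.term (fun n => ((moebius n : ℤ) : ℂ)) x n‖) 1, lt_max_of_lt_right one_pos,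
    fun s hs => le_max_of_le_left ?_⟩
  · rw [← norm_inv, ← LSeries_one_eq_riemannZeta (hx.trans_le hs),
      inv_eq_of_mul_eq_one_right (LSeries_one_mul_Lseries_moebius (hx.trans_le hs))]
    exact LSeries.norm_le_of_le_re (LSeriesSummable_moebius_iff.2 (by simpa using hx)) hs

lemma exists_norm_logDeriv_riemannZeta_le {x : ℝ} (hx : 1 < x) :
    ∃ C : ℝ, 0 < C ∧ ∀ s : ℂ, x ≤ s.re → ‖deriv riemannZeta s / riemannZeta s‖ ≤ C := by
  refine ⟨max (∑' n, ‖LSeries.term (fun n => ((vonMangoldt n : ℝ) : ℂ)) x n‖) 1, lt_max_of_lt_right one_pos,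
    fun s hs => le_max_of_le_left ?_⟩
  · have h := LSeries_vonMangoldt_eq_deriv_riemannZeta_div (hx.trans_le hs)
    rw [neg_div] at h
    rw [← norm_neg, ← h]
    exact LSeries.norm_le_of_le_re (LSeriesSummable_vonMangoldt (by simpa using hx)) hs

/-- The real part is controlled by the bounds on `ζ` and `1/ζ`, the imaginary part by `π` since the
branch is principal. -/
lemma exists_norm_log_riemannZeta_le {x : ℝ} (hx : 1 < x) :
    ∃ C : ℝ, 0 < C ∧ ∀ s : ℂ, x ≤ s.re → ‖log (riemannZeta s)‖ ≤ C := by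
  obtain ⟨A, hA0, hA⟩ := exists_norm_riemannZeta_le hx
  obtain ⟨B, hB0, hB⟩ := exists_norm_riemannZeta_inv_le hx
  refine ⟨|Real.log A| + |Real.log B| + Real.pi, by positivity, fun s hs => ?_⟩
  have hz : 0 < ‖riemannZeta s‖ :=
    norm_pos_iff.2 (riemannZeta_ne_zero_of_one_lt_re (hx.trans_le hs))
  refine (norm_le_abs_re_add_abs_im _).trans (add_le_add ?_ ?_)
  · rw [Complex.log_re, abs_le]
    have h1 := Real.log_le_log hz (hA s hs)
    have h2 := Real.log_le_log (inv_pos.2 hz) (hB s hs)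
    rw [Real.log_inv] at h2
    constructor <;> linarith [le_abs_self (Real.log A), le_abs_self (Real.log B),
      abs_nonneg (Real.log A), abs_nonneg (Real.log B)]
  · rw [Complex.log_im]; exact abs_arg_le_pi _

end HalfPlaneBounds

/-! ### Littlewood's bound for `1/ζ` under RH -/

section RH
open Set Filter Topology Complex Metric

lemma RiemannHypothesis.riemannZeta_ne_zero (hRH : RiemannHypothesis) {s : ℂ}
    (hs : 1 / 2 < s.re) : riemannZeta s ≠ 0 := by
  intro h
  -- At the pole `riemannZeta` has a conventional value, which is nonzero.
  by_cases h1 : s = 1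
  · rw [h1] at h; exact riemannZeta_one_ne_zero h
  · refine absurd (hRH s h ?_ h1) hs.ne'
    rintro ⟨n, rfl⟩
    have : (-2 * ((n : ℂ) + 1)).re = -2 * ((n : ℝ) + 1) := by simp
    rw [this] at hs
    have : (0 : ℝ) ≤ n := n.cast_nonneg
    linarith

/-- Under the Riemann hypothesis, a branch of `log ζ` on the disc of radius `3 / 2` about `2 + it`,
with bounds on two concentric circles. -/
lemma RiemannHypothesis.exists_log_riemannZeta (hRH : RiemannHypothesis) {r : ℝ} (hr0 : 0 < r)
    (hr : r < 3 / 2) :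
    ∃ K A : ℝ, 1 ≤ K ∧ 0 < A ∧ ∀ t : ℝ, 3 ≤ |t| → ∃ g : ℂ → ℂ,
      DifferentiableOn ℂ g (ball (2 + t * I) (3 / 2)) ∧
      (∀ z ∈ ball (2 + t * I) (3 / 2), exp (g z) = riemannZeta z) ∧
      (∀ z ∈ closedBall (2 + t * I) (1 / 2), ‖g z‖ ≤ K) ∧
      ∀ z ∈ closedBall (2 + t * I) r, ‖g z‖ ≤ A * Real.log |t| := by
  obtain ⟨K₀, hK₀, hlog⟩ := exists_norm_log_riemannZeta_le (x := 3 / 2) (by norm_num)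
  obtain ⟨K₁, hK₁, hder⟩ := exists_norm_logDeriv_riemannZeta_le (x := 3 / 2) (by norm_num)
  have hr' : 0 < 3 / 2 - r := by linarith
  -- The first constant is the mean value inequality over radius `1/2`, plus 1 to force `1 ≤ K`. The
  -- second is Borel–Carathéodory at radius `3/2` with real part at most `3 log|t|`.
  refine ⟨K₀ + K₁ * (1 / 2) + 1, 2 * 3 * r / (3 / 2 - r) + K₀ * (3 / 2 + r) / (3 / 2 - r),
    by nlinarith, by positivity, fun t ht => ?_⟩
  set c : ℂ := 2 + t * I with hc
  have hcre : c.re = 2 := by simp [hc]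
  have hcim : c.im = t := by simp [hc]
  have hre : ∀ {z : ℂ} {ρ : ℝ}, ‖z - c‖ < ρ → 2 - ρ < z.re := by
    intro z ρ hz
    have := (abs_le.1 ((abs_re_le_norm (z - c)))).1
    rw [sub_re, hcre] at this
    linarith
  have him : ∀ {z : ℂ}, ‖z - c‖ < 3 / 2 → 3 / 2 < |z.im| := by
    intro z hz
    have h1 := abs_im_le_norm (z - c)
    rw [sub_im, hcim] at h1
    have h2 := abs_sub_abs_le_abs_sub t z.im
    rw [abs_sub_comm] at h2
    linarith
  have hne1 : ∀ {z : ℂ}, ‖z - c‖ < 3 / 2 → z ≠ 1 := by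
    rintro z hz rfl
    have := him hz
    norm_num at this
  have hdiff : DifferentiableOn ℂ riemannZeta (ball c (3 / 2)) := fun z hz =>
    (differentiableAt_riemannZeta (hne1 (mem_ball_iff_norm.1 hz))).differentiableWithinAt
  obtain ⟨g, hgc, hg, hexp⟩ := exists_log_of_differentiableOn_ball (by norm_num) hdiff fun z hz =>
    hRH.riemannZeta_ne_zero (by have := hre (mem_ball_iff_norm.1 hz); linarith)
  have hgd : DifferentiableOn ℂ g (ball c (3 / 2)) := fun z hz =>
    (hg z hz).differentiableAt.differentiableWithinAt
  have hgc' : ‖g c‖ ≤ K₀ := by rw [hgc]; exact hlog c (by rw [hcre]; norm_num)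
  have ht1 : 1 ≤ Real.log |t| := by
    rw [Real.le_log_iff_exp_le (by linarith)]
    linarith [Real.exp_one_lt_d9]
  refine ⟨g, hgd, hexp, fun z hz => ?_, fun z hz => ?_⟩
  · have h := (convex_closedBall c (1 / 2)).norm_image_sub_le_of_norm_hasDerivWithin_le
      (f := g) (f' := fun z => deriv riemannZeta z / riemannZeta z) (C := K₁)
      (fun w hw => (hg w (closedBall_subset_ball (by norm_num) hw)).hasDerivWithinAt)
      (fun w hw => hder w (by
        have h1 := (abs_le.1 ((abs_re_le_norm (w - c)))).1
        rw [sub_re, hcre] at h1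
        have := mem_closedBall_iff_norm.1 hw
        linarith))
      (mem_closedBall_self (by norm_num)) hz
    have h2 := norm_le_norm_sub_add (g z) (g c)
    have h3 := mul_le_mul_of_nonneg_left (mem_closedBall_iff_norm.1 hz) hK₁.le
    linarith
  · have hz' := mem_closedBall_iff_norm.1 hz
    have hshift : ∀ w ∈ ball (0 : ℂ) (3 / 2), c + w ∈ ball c (3 / 2) := by
      intro w hw; simpa using hw
    have hM : MapsTo (fun w => g (c + w)) (ball 0 (3 / 2)) {w | w.re ≤ 3 * Real.log |t|} := by
      intro w hw
      have hw' := hshift w hw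
      have hn := mem_ball_iff_norm.1 hw'
      have hre' := hre hn
      have hz0 : riemannZeta (c + w) ≠ 0 := by rw [← hexp _ hw']; exact exp_ne_zero _
      have hreq : (g (c + w)).re = Real.log ‖riemannZeta (c + w)‖ := by
        rw [← hexp _ hw', Complex.norm_exp, Real.log_exp]
      have hb := norm_riemannZeta_le (s := c + w) (by linarith) (hne1 hn)
      have hs1 : 3 / 2 ≤ ‖c + w - 1‖ := by
        have := abs_im_le_norm (c + w - 1)
        have h' := him hn
        simp only [sub_im, one_im, sub_zero] at this
        linarith
      have hs : ‖c + w‖ ≤ 3 * |t| := by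
        have h1 : ‖c‖ ≤ 2 + |t| := by
          refine (norm_add_le _ _).trans ?_
          simp
        have h2 := norm_add_le c w
        have h3 : ‖w‖ < 3 / 2 := by simpa using hw
        linarith
      have h1 : ‖c + w‖ / ‖c + w - 1‖ ≤ ‖c + w‖ / (3 / 2) := by gcongr
      have h2 : ‖c + w‖ / (c + w).re ≤ ‖c + w‖ / (1 / 2) := by gcongr; linarith
      -- The two quotients sum to at most `(2/3 + 2) · 3|t| = 8|t|`, and `|t|² ≥ 9`.
      have hfin : ‖riemannZeta (c + w)‖ ≤ |t| ^ 3 := by nlinarith [norm_nonneg (c + w), mul_self_nonneg (|t| - 3)]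
      change (g (c + w)).re ≤ _
      rw [hreq]
      refine (Real.log_le_log (norm_pos_iff.2 hz0) hfin).trans_eq ?_
      rw [Real.log_pow]; norm_num
    have hbc := borelCaratheodory (f := fun w => g (c + w)) (z := z - c)
      (by positivity) (hgd.comp (by fun_prop) hshift) hM (by norm_num)
      (by simpa using hz'.trans_lt hr)
    simp only [add_sub_cancel, add_zero] at hbc
    refine hbc.trans ?_
    have e1 : 2 * (3 * Real.log |t|) * ‖z - c‖ / (3 / 2 - ‖z - c‖) ≤
        2 * (3 * Real.log |t|) * r / (3 / 2 - r) := by gcongr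
    have e2 : ‖g c‖ * (3 / 2 + ‖z - c‖) / (3 / 2 - ‖z - c‖) ≤
        K₀ * (3 / 2 + r) / (3 / 2 - r) := by gcongr
    have e3 : K₀ * (3 / 2 + r) / (3 / 2 - r) ≤ K₀ * (3 / 2 + r) / (3 / 2 - r) * Real.log |t| :=
      le_mul_of_one_le_right (by positivity) ht1
    calc _ ≤ _ := add_le_add e1 (e2.trans e3)
      _ = _ := by ring

/-- **Littlewood's bound**: under the Riemann hypothesis `1 / ζ(s) = O(|t| ^ ε)` in every
half-plane `σ ≤ re s` with `1 / 2 < σ`. -/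
lemma RiemannHypothesis.exists_norm_riemannZeta_inv_le (hRH : RiemannHypothesis) {σ ε : ℝ}
    (hσ : 1 / 2 < σ) (hσ1 : σ ≤ 1) (hε : 0 < ε) :
    ∃ C : ℝ, 0 < C ∧ ∀ s : ℂ, σ ≤ s.re → 3 ≤ |s.im| → ‖riemannZeta s‖⁻¹ ≤ C * |s.im| ^ ε := by
  obtain ⟨B, hB0, hB⟩ := _root_.exists_norm_riemannZeta_inv_le (x := 3 / 2) (by norm_num)
  -- A point with `σ ≤ re s` is at distance at most `2 - σ` from `2 + it`; an outer radius strictly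
  -- beyond that makes `θ < 1`.
  obtain ⟨r, hr1, hr2⟩ := exists_between (show 2 - σ < 3 / 2 by linarith)
  obtain ⟨K, A, hK, hA, hlog⟩ := hRH.exists_log_riemannZeta (r := r) (by linarith) hr2
  have hlr : Real.log (1 / 2) < Real.log r := Real.log_lt_log (by norm_num) (by linarith)
  set θ : ℝ := (Real.log (2 - σ) - Real.log (1 / 2)) / (Real.log r - Real.log (1 / 2)) with hθ
  have hθ0 : 0 ≤ θ := div_nonneg
    (sub_nonneg.2 (Real.log_le_log (by norm_num) (by linarith))) (by linarith)
  have hθ1 : θ < 1 := by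
    rw [hθ, div_lt_one (by linarith)]
    have := Real.log_lt_log (by linarith) hr1
    linarith
  obtain ⟨D, hD0, hD⟩ := exists_rpow_le_mul_add hθ0 hθ1 (div_pos hε hA)
  have hK0 : 0 < K := by linarith
  set E : ℝ := ε / A * K + K * D with hE
  refine ⟨max (Real.exp E) B, lt_max_of_lt_right hB0, fun s hs ht => ?_⟩
  have ht0 : 0 < |s.im| := by linarith
  have htε : 1 ≤ |s.im| ^ ε := Real.one_le_rpow (by linarith) hε.le
  rcases le_total (3 / 2) s.re with h32 | h32
  · calc _ ≤ B * 1 := by rw [mul_one]; exact hB s h32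
      _ ≤ _ := by gcongr; exact le_max_right _ _
  obtain ⟨g, hgd, hexp, hgK, hgA⟩ := hlog s.im ht
  have hsc : s - (2 + s.im * I) = ((s.re - 2 : ℝ) : ℂ) := by
    apply Complex.ext <;> simp
  have hn : ‖s - (2 + s.im * I)‖ = 2 - s.re := by
    rw [hsc, Complex.norm_real, Real.norm_eq_abs, abs_of_nonpos (by linarith)]; ring
  have hL : 0 ≤ Real.log |s.im| := Real.log_nonneg (by linarith)
  -- Adding `K` ensures `b / K ≥ 1`, so the exponent `η` may be raised to the uniform `θ`.
  set b : ℝ := A * Real.log |s.im| + K with hb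
  have hbK : K ≤ b := by rw [hb]; nlinarith
  have hb0 : 0 < b := hK0.trans_le hbK
  have h3 := norm_le_interp_of_mem_annulus (f := g) (z := s) (r₁ := 1 / 2) (r₂ := r) (a := K)
    (b := b) (by norm_num) (by linarith) hr2 hgd
    (fun w hw => hgK w (sphere_subset_closedBall hw))
    (fun w hw => (hgA w (sphere_subset_closedBall hw)).trans (by linarith))
    (by linarith) (by linarith)
  set η := (Real.log ‖s - (2 + s.im * I)‖ - Real.log (1 / 2)) / (Real.log r - Real.log (1 / 2))
    with hη
  have hηθ : η ≤ θ := by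
    rw [hη, hn]
    have : Real.log (2 - s.re) ≤ Real.log (2 - σ) := Real.log_le_log (by linarith) (by linarith)
    rw [hθ]
    gcongr
  have hg : ‖g s‖ ≤ ε * Real.log |s.im| + E := by
    calc ‖g s‖ ≤ K ^ (1 - η) * b ^ η := h3
      _ = K * (b / K) ^ η := by
        rw [Real.rpow_sub hK0, Real.rpow_one, Real.div_rpow hb0.le hK0.le]; ring
      _ ≤ K * (b / K) ^ θ := by
        gcongr
        exact (one_le_div hK0).2 hbK
      _ ≤ K * (ε / A * (b / K) + D) := by
        gcongr
        exact hD _ (by positivity)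
      _ = ε * Real.log |s.im| + E := by
        rw [hb, hE]; field_simp; ring
  have hsm : s ∈ ball (2 + s.im * I) (3 / 2) := by
    rw [mem_ball_iff_norm, hn]; linarith
  rw [← hexp s hsm, Complex.norm_exp, ← Real.exp_neg]
  have hre := (abs_le.1 (abs_re_le_norm (g s))).1
  calc Real.exp (-(g s).re) ≤ Real.exp (E + Real.log |s.im| * ε) := by
        apply Real.exp_le_exp.2; linarith
    _ = Real.exp E * |s.im| ^ ε := by rw [Real.exp_add, Real.rpow_def_of_pos ht0]
    _ ≤ _ := by gcongr; exact le_max_left _ _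

end RH

/-! ### Fourier coefficients of boundary values on the unit circle -/

section HardyCircle
open Set Filter Topology Complex Metric AddCircle

instance fact_zero_lt_two_pi : Fact (0 < 2 * Real.pi) := ⟨Real.two_pi_pos⟩

/-- Fourier coefficients on the circle of radius `r` as contour integrals. -/
lemma fourierCoeff_comp_toCircle (H : ℂ → ℂ) {r : ℝ} (hr : 0 < r) (n : ℤ) :
    fourierCoeff (fun t : AddCircle (2 * Real.pi) => H (r * (toCircle t : ℂ))) n =
      (r : ℂ) ^ n * ((2 * Real.pi * I)⁻¹ * ∮ z in C(0, r), z ^ (-n - 1) * H z) := by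
  have hr' : (r : ℂ) ≠ 0 := by exact_mod_cast hr.ne'
  have hpi : (Real.pi : ℂ) ≠ 0 := by exact_mod_cast Real.pi_ne_zero
  rw [fourierCoeff_eq_intervalIntegral _ n 0, zero_add, circleIntegral]
  have h : ∀ θ : ℝ, deriv (circleMap 0 r) θ • ((circleMap 0 r θ) ^ (-n - 1) * H (circleMap 0 r θ)) =
      (I * (r : ℂ) ^ (-n)) * (fourier (-n) (θ : AddCircle (2 * Real.pi)) •
        H (r * (toCircle (θ : AddCircle (2 * Real.pi)) : ℂ))) := by
    intro θ
    have hz : circleMap 0 r θ ≠ 0 := by simpa using hr.ne'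
    have hc : (r * (toCircle (θ : AddCircle (2 * Real.pi)) : ℂ)) = circleMap 0 r θ := by
      rw [toCircle_apply_mk, Circle.coe_exp, div_self Real.two_pi_pos.ne', one_mul, circleMap_zero]
    have hf : fourier (-n) (θ : AddCircle (2 * Real.pi)) = cexp (θ * I) ^ (-n) := by
      rw [fourier_coe_apply, ← Complex.exp_int_mul]
      congr 1
      push_cast
      field_simp
    rw [hc, hf, deriv_circleMap, zpow_sub_one₀ hz]
    simp only [smul_eq_mul]
    have hz' : circleMap 0 r θ ^ (-n) = (r : ℂ) ^ (-n) * cexp (θ * I) ^ (-n) := by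
      rw [circleMap_zero, mul_zpow]
    rw [hz']
    field_simp
  simp_rw [h]
  rw [intervalIntegral.integral_const_mul, zpow_neg, Complex.real_smul]
  push_cast
  have := zpow_ne_zero n hr'
  field_simp

lemma fourierCoeff_comp_toCircle_of_nonneg {H : ℂ → ℂ} (hH : DifferentiableOn ℂ H (ball 0 1))
    {r : ℝ} (hr : 0 < r) (hr1 : r < 1) (n : ℕ) :
    fourierCoeff (fun t : AddCircle (2 * Real.pi) => H (r * (toCircle t : ℂ))) n =
      (r : ℂ) ^ n * (iteratedDeriv n H 0 / n.factorial) := by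
  have h := (hH.mono (closedBall_subset_ball hr1)).circleIntegral_one_div_sub_center_pow_smul hr n
  have hpi : (Real.pi : ℂ) ≠ 0 := by exact_mod_cast Real.pi_ne_zero
  have hz : ∀ z : ℂ, z ^ (-(n : ℤ) - 1) * H z = (1 / (z - 0) ^ (n + 1)) • H z := by
    intro z
    rw [sub_zero, smul_eq_mul, one_div, show -(n : ℤ) - 1 = -((n + 1 : ℕ) : ℤ) by push_cast; ring,
      zpow_neg, zpow_natCast]
  rw [fourierCoeff_comp_toCircle H hr, zpow_natCast]
  simp_rw [hz]
  rw [h, smul_eq_mul]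
  field_simp

/-- The contour integrand is `z^n H(z)`, holomorphic, so Cauchy's theorem applies. -/
lemma fourierCoeff_comp_toCircle_of_neg {H : ℂ → ℂ} (hH : DifferentiableOn ℂ H (ball 0 1))
    {r : ℝ} (hr : 0 < r) (hr1 : r < 1) (n : ℕ) :
    fourierCoeff (fun t : AddCircle (2 * Real.pi) => H (r * (toCircle t : ℂ))) (Int.negSucc n) = 0 := by
  rw [fourierCoeff_comp_toCircle H hr]
  have hz : ∀ z : ℂ, z ^ (-Int.negSucc n - 1) = z ^ n := by
    intro z
    rw [show -Int.negSucc n - 1 = (n : ℤ) by rw [Int.negSucc_eq]; ring, zpow_natCast]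
  simp_rw [hz]
  have hd : DifferentiableOn ℂ (fun z => z ^ n * H z) (ball 0 1) := by fun_prop
  rw [circleIntegral_eq_zero_of_differentiable_on_off_countable hr.le countable_empty
    (hd.continuousOn.mono (closedBall_subset_ball hr1))
    (fun z hz => hd.differentiableAt
      (isOpen_ball.mem_nhds (ball_subset_ball hr1.le hz.1)))]
  simp

/-- Radial limits commute with Fourier coefficients under a dominating function. -/
lemma tendsto_fourierCoeff_comp_toCircle {H : ℂ → ℂ} (hH : DifferentiableOn ℂ H (ball 0 1))
    {G : AddCircle (2 * Real.pi) → ℝ} (hG : Integrable G haarAddCircle)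
    (hbound : ∀ r : ℝ, 0 < r → r < 1 → ∀ᵐ t ∂haarAddCircle (T := 2 * Real.pi),
      ‖H (r * (toCircle t : ℂ))‖ ≤ G t)
    (hlim : ∀ᵐ t ∂haarAddCircle (T := 2 * Real.pi),
      Tendsto (fun r : ℝ => H (r * (toCircle t : ℂ))) (𝓝[<] 1) (𝓝 (H (toCircle t)))) (n : ℤ) :
    Tendsto (fun r : ℝ => fourierCoeff (fun t : AddCircle (2 * Real.pi) =>
      H (r * (toCircle t : ℂ))) n) (𝓝[<] 1)
      (𝓝 (fourierCoeff (fun t : AddCircle (2 * Real.pi) => H (toCircle t)) n)) := by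
  have hev : ∀ᶠ r : ℝ in 𝓝[<] 1, 0 < r ∧ r < 1 := Ioo_mem_nhdsLT one_pos
  refine tendsto_integral_filter_of_dominated_convergence G ?_ ?_ hG ?_
  · filter_upwards [hev] with r hr
    refine Continuous.aestronglyMeasurable ?_
    have hc : Continuous fun t : AddCircle (2 * Real.pi) => H (r * (toCircle t : ℂ)) := by
      refine hH.continuousOn.comp_continuous ?_ fun t => ?_
      · exact continuous_const.mul (continuous_induced_dom.comp continuous_toCircle)
      · simpa [abs_of_pos hr.1, Circle.norm_coe] using hr.2
    exact (fourier (-n)).continuous.smul hc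
  · filter_upwards [hev] with r hr
    filter_upwards [hbound r hr.1 hr.2] with t ht
    rw [norm_smul, fourier_apply, Circle.norm_coe, one_mul]
    exact ht
  · filter_upwards [hlim] with t ht
    exact ht.const_smul _

/-- On radius `r` the coefficients are `r^n` times the Taylor coefficients, or 0; let `r → 1` by
dominated convergence. -/
lemma fourierCoeff_boundary {H : ℂ → ℂ} (hH : DifferentiableOn ℂ H (ball 0 1))
    {G : AddCircle (2 * Real.pi) → ℝ} (hG : Integrable G haarAddCircle)
    (hbound : ∀ r : ℝ, 0 < r → r < 1 → ∀ᵐ t ∂haarAddCircle (T := 2 * Real.pi),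
      ‖H (r * (toCircle t : ℂ))‖ ≤ G t)
    (hlim : ∀ᵐ t ∂haarAddCircle (T := 2 * Real.pi),
      Tendsto (fun r : ℝ => H (r * (toCircle t : ℂ))) (𝓝[<] 1) (𝓝 (H (toCircle t)))) :
    (∀ n : ℕ, fourierCoeff (fun t : AddCircle (2 * Real.pi) => H (toCircle t)) n =
      iteratedDeriv n H 0 / n.factorial) ∧
    ∀ n : ℕ, fourierCoeff (fun t : AddCircle (2 * Real.pi) => H (toCircle t)) (Int.negSucc n) = 0 := by
  have hev : ∀ᶠ r : ℝ in 𝓝[<] 1, 0 < r ∧ r < 1 := Ioo_mem_nhdsLT one_pos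
  have hT := tendsto_fourierCoeff_comp_toCircle hH hG hbound hlim
  refine ⟨fun n => tendsto_nhds_unique (hT n) ?_, fun n => tendsto_nhds_unique (hT _) ?_⟩
  · have h1 : Tendsto (fun r : ℝ => (r : ℂ) ^ n * (iteratedDeriv n H 0 / n.factorial)) (𝓝[<] 1)
        (𝓝 (((1 : ℝ) : ℂ) ^ n * (iteratedDeriv n H 0 / n.factorial))) := by
      refine Tendsto.mono_left (Continuous.tendsto ?_ 1) nhdsWithin_le_nhds
      fun_prop
    simp only [ofReal_one, one_pow, one_mul] at h1
    refine h1.congr' ?_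
    filter_upwards [hev] with r hr
    exact (fourierCoeff_comp_toCircle_of_nonneg hH hr.1 hr.2 n).symm
  · refine tendsto_const_nhds.congr' ?_
    filter_upwards [hev] with r hr
    exact (fourierCoeff_comp_toCircle_of_neg hH hr.1 hr.2 n).symm

/-- **Parseval's identity** for boundary values of a holomorphic function on the unit disc. -/
lemma hasSum_sq_norm_iteratedDeriv {H : ℂ → ℂ} (hH : DifferentiableOn ℂ H (ball 0 1))
    {G : AddCircle (2 * Real.pi) → ℝ} (hG : Integrable G haarAddCircle)
    (hbound : ∀ r : ℝ, 0 < r → r < 1 → ∀ᵐ t ∂haarAddCircle (T := 2 * Real.pi),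
      ‖H (r * (toCircle t : ℂ))‖ ≤ G t)
    (hlim : ∀ᵐ t ∂haarAddCircle (T := 2 * Real.pi),
      Tendsto (fun r : ℝ => H (r * (toCircle t : ℂ))) (𝓝[<] 1) (𝓝 (H (toCircle t))))
    (hL2 : MemLp (fun t : AddCircle (2 * Real.pi) => H (toCircle t)) 2 haarAddCircle) :
    HasSum (fun n : ℕ => ‖iteratedDeriv n H 0 / n.factorial‖ ^ 2)
      (∫ t : AddCircle (2 * Real.pi), ‖H (toCircle t)‖ ^ 2 ∂haarAddCircle) := by
  obtain ⟨hpos, hneg⟩ := fourierCoeff_boundary hH hG hbound hlim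
  have h := hasSum_sq_fourierCoeff hL2.toLp
  have hae := hL2.coeFn_toLp
  have hint : ∫ t : AddCircle (2 * Real.pi), ‖hL2.toLp _ t‖ ^ 2 ∂haarAddCircle =
      ∫ t : AddCircle (2 * Real.pi), ‖H (toCircle t)‖ ^ 2 ∂haarAddCircle :=
    integral_congr_ae (by filter_upwards [hae] with t ht; rw [ht])
  rw [hint, fourierCoeff_congr_ae hae,
    ← (Nat.cast_injective (R := ℤ)).hasSum_iff (fun n hn => ?_)] at h
  · simpa only [Function.comp_def, hpos] using h
  · rcases n with k | k
    · exact absurd ⟨k, rfl⟩ hn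
    · simp [hneg]

end HardyCircle

/-! ### Higher derivatives of `G(u/(1+u))` -/

section Lah
open Finset

/-- The signed Lah numbers, which expand derivatives of `G (u / (1 + u))`. -/
noncomputable def signedLah : ℕ → ℕ → ℂ
  | 0, 0 => 1
  | 0, _ + 1 => 0
  | n + 1, 0 => -n * signedLah n 0
  | n + 1, k + 1 => signedLah n k - (n + k + 1) * signedLah n (k + 1)

lemma signedLah_eq_zero_of_lt {n k : ℕ} (h : n < k) : signedLah n k = 0 := by
  induction n generalizing k with
  | zero =>
    obtain ⟨k, rfl⟩ := Nat.exists_eq_succ_of_ne_zero h.ne'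
    rfl
  | succ n ih =>
    obtain ⟨k, rfl⟩ := Nat.exists_eq_succ_of_ne_zero (Nat.ne_zero_of_lt h)
    rw [signedLah, ih (by omega), ih (by omega)]
    ring

lemma signedLah_succ_zero (n : ℕ) : signedLah (n + 1) 0 = 0 := by
  induction n with
  | zero => simp [signedLah]
  | succ n ih => rw [signedLah, ih, mul_zero]

lemma signedLah_succ_succ (n k : ℕ) : signedLah (n + 1) (k + 1) =
    (-1) ^ (n + k) * (n + 1).choose (k + 1) * n.factorial / k.factorial := by
  induction n generalizing k with
  | zero =>
    cases k with
    | zero => simp [signedLah]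
    | succ k => simp [signedLah, Nat.choose_eq_zero_of_lt (show 1 < k + 1 + 1 by omega)]
  | succ n ih =>
    rw [signedLah]
    cases k with
    | zero =>
      rw [signedLah_succ_zero, ih]
      simp [Nat.factorial_succ]
      ring
    | succ k =>
      rw [ih, ih]
      have h1 : ((n + 1).choose (k + 2) : ℂ) * (k + 2) = (n + 1).choose (k + 1) * (n - k) := by
        rcases le_or_gt k n with hk | hk
        · have := Nat.choose_succ_right_eq (n + 1) (k + 1)
          rw [show n + 1 - (k + 1) = n - k by omega] at this
          have := congrArg (Nat.cast (R := ℂ)) this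
          push_cast [Nat.cast_sub hk] at this
          linear_combination this
        · rw [Nat.choose_eq_zero_of_lt (show n + 1 < k + 2 by omega),
            Nat.choose_eq_zero_of_lt (show n + 1 < k + 1 by omega)]
          simp
      have hk : (k.factorial : ℂ) ≠ 0 := by exact_mod_cast k.factorial_ne_zero
      have hk1 : (k : ℂ) + 1 ≠ 0 := by exact_mod_cast k.succ_ne_zero
      rw [Nat.choose_succ_succ (n + 1) (k + 1), Nat.factorial_succ n, Nat.factorial_succ k]
      push_cast
      field_simp
      ring_nf at h1 ⊢
      linear_combination n.factorial * (-1) ^ n * (-1) ^ k * h1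

/-- With `q = 1/(1+u)`, differentiating `G^{(k)}(1-q) q^{n+k}` gives `G^{(k+1)}(1-q) q^{n+k+2} -
(n+k) G^{(k)}(1-q) q^{n+k+1}`, which is the recursion of `signedLah`. -/
lemma iteratedDeriv_comp_div_one_add {G : ℂ → ℂ} {U V : Set ℂ} (hG : AnalyticOnNhd ℂ G U)
    (hV : IsOpen V) (h1 : ∀ u ∈ V, 1 + u ≠ 0) (hU : ∀ u ∈ V, 1 - (1 + u)⁻¹ ∈ U) (n : ℕ) :
    ∀ u ∈ V, iteratedDeriv n (fun u => G (1 - (1 + u)⁻¹)) u =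
      ∑ k ∈ range (n + 1), signedLah n k *
        (iteratedDeriv k G (1 - (1 + u)⁻¹) * ((1 + u)⁻¹) ^ (n + k)) := by
  induction n with
  | zero => intro u _; simp [signedLah]
  | succ n ih =>
    intro u hu
    set q : ℂ := (1 + u)⁻¹ with hq
    have hqd : HasDerivAt (fun u : ℂ => (1 + u)⁻¹) (-q ^ 2) u := by
      refine (((hasDerivAt_id u).const_add 1).inv (h1 u hu)).congr_deriv ?_
      simp [hq, neg_div]
    have hmd : HasDerivAt (fun u : ℂ => 1 - (1 + u)⁻¹) (q ^ 2) u := by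
      simpa using hqd.const_sub 1
    have hD : ∀ k, HasDerivAt (fun u : ℂ => iteratedDeriv k G (1 - (1 + u)⁻¹))
        (iteratedDeriv (k + 1) G (1 - q) * q ^ 2) u := by
      intro k
      have ha : AnalyticAt ℂ (iteratedDeriv k G) (1 - q) := by
        rw [iteratedDeriv_eq_iterate]
        exact hG.iterated_deriv k _ (hU u hu)
      have hd := ha.differentiableAt.hasDerivAt
      rw [← iteratedDeriv_succ] at hd
      exact hd.comp u hmd
    have hterm : ∀ k, HasDerivAt (fun u : ℂ => signedLah n k *
        (iteratedDeriv k G (1 - (1 + u)⁻¹) * ((1 + u)⁻¹) ^ (n + k)))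
        (signedLah n k * (iteratedDeriv (k + 1) G (1 - q) * q ^ (n + k + 2)) -
          (n + k) * signedLah n k * (iteratedDeriv k G (1 - q) * q ^ (n + k + 1))) u := by
      intro k
      refine (((hD k).mul (hqd.fun_pow (n + k))).const_mul (signedLah n k)).congr_deriv ?_
      rcases Nat.eq_zero_or_pos (n + k) with h0 | h0
      · obtain ⟨rfl, rfl⟩ := Nat.add_eq_zero_iff.1 h0
        simp [← hq]
      · obtain ⟨j, hj⟩ := Nat.exists_eq_succ_of_ne_zero h0.ne'
        have hj' : ((n : ℂ) + k) = j + 1 := by exact_mod_cast hj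
        rw [hj', hj]
        simp only [Nat.succ_eq_add_one, Nat.add_sub_cancel, ← hq, Nat.cast_add, Nat.cast_one]
        ring
    have hev : iteratedDeriv n (fun u => G (1 - (1 + u)⁻¹)) =ᶠ[nhds u] fun u =>
        ∑ k ∈ range (n + 1), signedLah n k *
          (iteratedDeriv k G (1 - (1 + u)⁻¹) * ((1 + u)⁻¹) ^ (n + k)) := by
      filter_upwards [hV.mem_nhds hu] with w hw using ih w hw
    rw [iteratedDeriv_succ, hev.deriv_eq, (HasDerivAt.fun_sum fun k _ => hterm k).deriv,
      sum_sub_distrib, sum_range_succ' _ (n + 1)]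
    -- Index shift; the extra top term vanishes because `signedLah n (n + 1) = 0`.
    have hlast : ∑ k ∈ range (n + 1), (n + k : ℂ) * signedLah n k *
          (iteratedDeriv k G (1 - q) * q ^ (n + k + 1)) =
        ∑ k ∈ range (n + 1), (n + (k + 1 : ℕ) : ℂ) * signedLah n (k + 1) *
          (iteratedDeriv (k + 1) G (1 - q) * q ^ (n + (k + 1) + 1)) +
          (n + (0 : ℕ) : ℂ) * signedLah n 0 * (iteratedDeriv 0 G (1 - q) * q ^ (n + 0 + 1)) := by
      rw [← sum_range_succ' (fun k : ℕ => (n + k : ℂ) * signedLah n k *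
          (iteratedDeriv k G (1 - q) * q ^ (n + k + 1))), sum_range_succ _ (n + 1),
        signedLah_eq_zero_of_lt (Nat.lt_succ_self n)]
      ring
    rw [hlast, ← sub_sub, ← sum_sub_distrib]
    simp only [signedLah]
    rw [sub_eq_add_neg]
    congr 1
    · refine sum_congr rfl fun k _ => ?_
      push_cast
      ring
    · push_cast
      ring

end Lah

/-! ### The Cayley transform carries `μ` to Haar measure -/

section CauchyMeasure
open Set Filter Topology Complex Metric AddCircle

/-- The Cayley angle `-2 arctan (2y)` as a point of the circle. -/
noncomputable def cayleyAngle (y : ℝ) : AddCircle (2 * Real.pi) := ((2 * Real.arctan (-2 * y) : ℝ) : AddCircle _)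

lemma hasDerivAt_two_mul_arctan_neg_two_mul (y : ℝ) :
    HasDerivAt (fun y : ℝ => 2 * Real.arctan (-2 * y)) (-(1 / (1 / 4 + y ^ 2))) y := by
  refine ((((hasDerivAt_id y).const_mul (-2)).arctan).const_mul 2).congr_deriv ?_
  have : (0 : ℝ) < 1 / 4 + y ^ 2 := by positivity
  have : (0 : ℝ) < 1 + (-2 * y) ^ 2 := by positivity
  simp only [id]
  field_simp
  ring

lemma image_two_mul_arctan_neg_two_mul :
    (fun y : ℝ => 2 * Real.arctan (-2 * y)) '' univ = Ioo (-Real.pi) Real.pi := by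
  ext x
  constructor
  · rintro ⟨y, -, rfl⟩
    have h1 := Real.neg_pi_div_two_lt_arctan (-2 * y)
    have h2 := Real.arctan_lt_pi_div_two (-2 * y)
    constructor <;> dsimp only <;> linarith
  · rintro ⟨h1, h2⟩
    refine ⟨-(Real.tan (x / 2) / 2), mem_univ _, ?_⟩
    dsimp only
    rw [show -2 * -(Real.tan (x / 2) / 2) = Real.tan (x / 2) by ring,
      Real.arctan_tan (by linarith) (by linarith)]
    ring

lemma injective_two_mul_arctan_neg_two_mul :
    Function.Injective (fun y : ℝ => 2 * Real.arctan (-2 * y)) := by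
  intro x y h
  have := Real.arctan_injective (mul_left_cancel₀ two_ne_zero h)
  linarith

/-- Change of variables: the density of `μ` is `1/(2π)` times the absolute derivative of the angle,
whose range is `(-π, π)`. -/
lemma map_muMeasure_two_mul_arctan : muMeasure.map (fun y : ℝ => 2 * Real.arctan (-2 * y)) =
    ENNReal.ofReal (1 / (2 * Real.pi)) •
      (volume.restrict (Ioc (-Real.pi) (-Real.pi + 2 * Real.pi))) := by
  have hm : Measurable (fun y : ℝ => 2 * Real.arctan (-2 * y)) := by fun_prop
  ext B hB
  have key := lintegral_image_eq_lintegral_abs_deriv_mul MeasurableSet.univ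
    (fun y _ => (hasDerivAt_two_mul_arctan_neg_two_mul y).hasDerivWithinAt)
    injective_two_mul_arctan_neg_two_mul.injOn (B.indicator 1)
  rw [image_two_mul_arctan_neg_two_mul, lintegral_indicator_one hB, Measure.restrict_univ] at key
  rw [Measure.map_apply hm hB, muMeasure, withDensity_apply _ (hm hB), Measure.smul_apply,
    show -Real.pi + 2 * Real.pi = Real.pi by ring, ← Measure.restrict_congr_set Ioo_ae_eq_Ioc, key,
    smul_eq_mul, ← lintegral_const_mul' _ _ ENNReal.ofReal_ne_top, ← lintegral_indicator (hm hB)]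
  refine lintegral_congr fun y => ?_
  have h0 : (0 : ℝ) < 1 / (1 / 4 + y ^ 2) := by positivity
  by_cases hy : 2 * Real.arctan (-2 * y) ∈ B
  · rw [indicator_of_mem (show y ∈ (fun y : ℝ => 2 * Real.arctan (-2 * y)) ⁻¹' B from hy),
      indicator_of_mem hy, abs_neg, abs_of_pos h0, ENNReal.ofReal_mul (by positivity)]
    simp
  · rw [indicator_of_notMem (show y ∉ (fun y : ℝ => 2 * Real.arctan (-2 * y)) ⁻¹' B from hy),
      indicator_of_notMem hy]
    simp

lemma measurePreserving_cayleyAngle : MeasurePreserving cayleyAngle muMeasure haarAddCircle := by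
  have hm : Measurable (fun y : ℝ => 2 * Real.arctan (-2 * y)) := by fun_prop
  have hmk := AddCircle.measurePreserving_mk (2 * Real.pi) (-Real.pi)
  refine ⟨hmk.measurable.comp hm, ?_⟩
  have : cayleyAngle = (fun x : ℝ => (x : AddCircle (2 * Real.pi))) ∘
      (fun y : ℝ => 2 * Real.arctan (-2 * y)) := rfl
  rw [this, ← Measure.map_map hmk.measurable hm, map_muMeasure_two_mul_arctan, Measure.map_smul,
    hmk.map_eq, volume_eq_smul_haarAddCircle, smul_smul,
    ← ENNReal.ofReal_mul (by positivity), one_div_mul_cancel Real.two_pi_pos.ne',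
    ENNReal.ofReal_one, one_smul]

lemma integral_haarAddCircle_eq_integral_muMeasure {E : Type*} [NormedAddCommGroup E]
    [NormedSpace ℝ E] {f : AddCircle (2 * Real.pi) → E}
    (hf : AEStronglyMeasurable f haarAddCircle) :
    ∫ t, f t ∂haarAddCircle = ∫ y, f (cayleyAngle y) ∂muMeasure := by
  rw [← measurePreserving_cayleyAngle.map_eq] at hf ⊢
  exact integral_map measurePreserving_cayleyAngle.measurable.aemeasurable hf

lemma toCircle_cayleyAngle (y : ℝ) :
    (toCircle (cayleyAngle y) : ℂ) = cexp (-(2 * I * Real.arctan (2 * y))) := by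
  rw [cayleyAngle, toCircle_apply_mk, Circle.coe_exp, div_self Real.two_pi_pos.ne', one_mul,
    neg_mul, Real.arctan_neg]
  congr 1
  push_cast
  ring

/-- The circle point is `(1 - 2iy)/(1 + 2iy)`. -/
lemma one_add_toCircle_cayleyAngle (y : ℝ) :
    1 + (toCircle (cayleyAngle y) : ℂ) = (1 / 2 + I * y)⁻¹ := by
  have hs : (0 : ℝ) < 1 + (2 * y) ^ 2 := by positivity
  have h1 : cexp (-(2 * I * Real.arctan (2 * y))) =
      (1 - I * (2 * y)) ^ 2 / (1 + (2 * y) ^ 2) := by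
    rw [show -(2 * I * (Real.arctan (2 * y) : ℂ)) =
      ((2 : ℕ) : ℂ) * ((-Real.arctan (2 * y) : ℝ) * I) by push_cast; ring, Complex.exp_nat_mul,
      Complex.exp_mul_I, ← Complex.ofReal_cos, ← Complex.ofReal_sin, Real.cos_neg, Real.sin_neg,
      Real.cos_arctan, Real.sin_arctan]
    have hsq : ((√(1 + (2 * y) ^ 2) : ℝ) : ℂ) ^ 2 = 1 + (2 * y) ^ 2 := by
      rw [← Complex.ofReal_pow, Real.sq_sqrt hs.le]; push_cast; ring
    have hne : ((√(1 + (2 * y) ^ 2) : ℝ) : ℂ) ≠ 0 := by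
      exact_mod_cast (Real.sqrt_pos.2 hs).ne'
    rw [← hsq]
    push_cast
    field_simp
    ring
  have h3 : (1 + (2 * y) ^ 2 : ℂ) ≠ 0 := by exact_mod_cast hs.ne'
  rw [toCircle_cayleyAngle, h1, one_add_div h3]
  refine eq_inv_of_mul_eq_one_left ?_
  rw [div_mul_eq_mul_div, div_eq_one_iff_eq h3]
  linear_combination (-2 * y ^ 2 + 4 * I * y ^ 3) * I_sq

end CauchyMeasure

/-! ### `1/ζ` on the disc and its majorant -/

/-- The holomorphic extension of `1 / ζ` across `s = 1`. -/
noncomputable def zetaInv (s : ℂ) : ℂ := (s - 1) / riemannZeta₁ s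

/-- The function `1 / ζ` on the half-plane `σ < re s`, transported to the unit disc. -/
noncomputable def discZetaInv (σ : ℝ) (u : ℂ) : ℂ := zetaInv (σ + 1 / 2 - (1 - (1 + u)⁻¹))

section ZetaInv
open Set Filter Topology Complex Metric AddCircle

/-- The point 1 must be excluded: there `zetaInv` is 0, but `1 / riemannZeta 1` is not. -/
lemma zetaInv_eq {s : ℂ} (hs : s ≠ 1) : zetaInv s = 1 / riemannZeta s := by
  rw [zetaInv, riemannZeta_eq_inv_sub_mul hs, one_div, mul_inv, inv_inv, div_eq_mul_inv]

lemma measurable_zetaInv : Measurable zetaInv :=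
  (measurable_id.sub_const 1).div differentiable_riemannZeta₁.continuous.measurable

lemma RiemannHypothesis.differentiableAt_zetaInv (hRH : RiemannHypothesis) {s : ℂ}
    (hs : 1 / 2 < s.re) : DifferentiableAt ℂ zetaInv s := by
  refine (differentiableAt_id.sub_const 1).div differentiable_riemannZeta₁.differentiableAt ?_
  by_cases h1 : s = 1
  · simp [h1]
  · intro h
    apply hRH.riemannZeta_ne_zero hs
    rw [riemannZeta_eq_inv_sub_mul h1, h, mul_zero]

/-- Three regions: Dirichlet series for `re s ≥ 2`, Littlewood for large height, compactness on the
remaining rectangle. -/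
lemma RiemannHypothesis.exists_norm_zetaInv_le (hRH : RiemannHypothesis) {σ ε : ℝ}
    (hσ : 1 / 2 < σ) (hσ1 : σ ≤ 1) (hε : 0 < ε) :
    ∃ C : ℝ, 0 < C ∧ ∀ s : ℂ, σ ≤ s.re → ‖zetaInv s‖ ≤ C * (1 + |s.im|) ^ ε := by
  obtain ⟨A, hA0, hA⟩ := hRH.exists_norm_riemannZeta_inv_le hσ hσ1 hε
  obtain ⟨B, hB0, hB⟩ := _root_.exists_norm_riemannZeta_inv_le one_lt_two
  obtain ⟨D, hD⟩ := (isCompact_Icc.reProdIm isCompact_Icc).exists_bound_of_continuousOn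
    (s := Icc σ 2 ×ℂ Icc (-3) 3) (f := zetaInv)
    (fun s hs => (hRH.differentiableAt_zetaInv (hσ.trans_le hs.1.1)).continuousAt.continuousWithinAt)
  refine ⟨max A (max B D), lt_max_of_lt_left hA0, fun s hs => ?_⟩
  have h1 : (1 : ℝ) ≤ (1 + |s.im|) ^ ε := Real.one_le_rpow (by linarith [abs_nonneg s.im]) hε.le
  have hM : 0 < max A (max B D) := lt_max_of_lt_left hA0
  rcases le_total 2 s.re with h2 | h2
  · have hs1 : s ≠ 1 := by rintro rfl; norm_num at h2
    rw [zetaInv_eq hs1, one_div, norm_inv]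
    calc _ ≤ B := hB s h2
      _ ≤ max A (max B D) := (le_max_left _ _).trans (le_max_right _ _)
      _ ≤ _ := le_mul_of_one_le_right hM.le h1
  rcases le_total 3 |s.im| with h3 | h3
  · have hs1 : s ≠ 1 := by rintro rfl; norm_num at h3
    rw [zetaInv_eq hs1, one_div, norm_inv]
    calc _ ≤ A * |s.im| ^ ε := hA s hs h3
      _ ≤ _ := by
        gcongr
        · exact le_max_left _ _
        · linarith
  · calc _ ≤ D := hD s ⟨⟨hs, h2⟩, abs_le.1 h3⟩
      _ ≤ max A (max B D) := (le_max_right _ _).trans (le_max_right _ _)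
      _ ≤ _ := le_mul_of_one_le_right hM.le h1

lemma half_le_re_inv_one_add {u : ℂ} (hu : ‖u‖ ≤ 1) (h0 : 1 + u ≠ 0) :
    1 / 2 ≤ ((1 + u)⁻¹).re := by
  have h := Complex.normSq_pos.2 h0
  rw [Complex.inv_re, div_le_div_iff₀ two_pos h]
  have h1 : Complex.normSq u ≤ 1 := by
    rw [Complex.normSq_eq_norm_sq]; exact pow_le_one₀ (norm_nonneg u) hu
  rw [Complex.normSq_apply] at h1 ⊢
  simp only [add_re, one_re, add_im, one_im]
  nlinarith

lemma one_add_ne_zero_of_norm_lt_one {u : ℂ} (hu : ‖u‖ < 1) : 1 + u ≠ 0 := by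
  intro h
  rw [eq_neg_of_add_eq_zero_right h] at hu
  simp at hu

lemma le_re_disc_map {σ : ℝ} {u : ℂ} (hu : ‖u‖ ≤ 1) (h0 : 1 + u ≠ 0) :
    σ ≤ ((σ : ℂ) + 1 / 2 - (1 - (1 + u)⁻¹)).re := by
  have := half_le_re_inv_one_add hu h0
  simp only [sub_re, add_re, ofReal_re, one_re, div_ofNat_re]
  linarith

lemma RiemannHypothesis.differentiableAt_discZetaInv (hRH : RiemannHypothesis) {σ : ℝ}
    (hσ : 1 / 2 < σ) {u : ℂ} (hu : ‖u‖ ≤ 1) (h0 : 1 + u ≠ 0) :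
    DifferentiableAt ℂ (discZetaInv σ) u := by
  have h1 := hRH.differentiableAt_zetaInv (hσ.trans_le (le_re_disc_map hu h0))
  have h2 : DifferentiableAt ℂ (fun u : ℂ => (σ : ℂ) + 1 / 2 - (1 - (1 + u)⁻¹)) u := by
    fun_prop (disch := exact h0)
  exact h1.comp u h2

lemma RiemannHypothesis.exists_norm_discZetaInv_le (hRH : RiemannHypothesis) {σ ε : ℝ}
    (hσ : 1 / 2 < σ) (hσ1 : σ ≤ 1) (hε : 0 < ε) :
    ∃ C : ℝ, 0 < C ∧ ∀ u : ℂ, ‖u‖ ≤ 1 → 1 + u ≠ 0 →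
      ‖discZetaInv σ u‖ ≤ C * (‖1 + u‖⁻¹) ^ ε := by
  obtain ⟨C, hC0, hC⟩ := hRH.exists_norm_zetaInv_le hσ hσ1 hε
  -- With `x = 1/|1+u|`, the height is at most `x` and `1 ≤ 2x`, so `1 + |im| ≤ 3x`.
  refine ⟨C * 3 ^ ε, by positivity, fun u hu h0 => (hC _ (le_re_disc_map hu h0)).trans ?_⟩
  have hpos : 0 < ‖1 + u‖ := norm_pos_iff.2 h0
  have h2 : ‖1 + u‖ ≤ 2 := (norm_add_le _ _).trans (by rw [norm_one]; linarith)
  rw [mul_assoc, ← Real.mul_rpow (by norm_num) (by positivity)]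
  have him : |((σ : ℂ) + 1 / 2 - (1 - (1 + u)⁻¹)).im| ≤ ‖1 + u‖⁻¹ := by
    rw [← norm_inv]
    refine le_trans (le_of_eq ?_) (abs_im_le_norm _)
    simp
  have h1 : 1 ≤ 2 * ‖1 + u‖⁻¹ := by
    rw [← div_eq_mul_inv, one_le_div hpos]; exact h2
  gcongr
  linarith

/-- Since `1 - r ≤ |1 + ru|`. This makes the majorant on the circle uniform along radii. -/
lemma norm_one_add_le_two_mul {u : ℂ} (hu : ‖u‖ = 1) {r : ℝ} (hr0 : 0 ≤ r) (hr1 : r ≤ 1) :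
    ‖1 + u‖ ≤ 2 * ‖1 + r * u‖ := by
  have h1 : ‖1 + u‖ ≤ ‖1 + r * u‖ + ‖((1 - r : ℝ) : ℂ) * u‖ := by
    refine (le_of_eq ?_).trans (norm_add_le _ _)
    congr 1; push_cast; ring
  have h2 : ‖((1 - r : ℝ) : ℂ) * u‖ = 1 - r := by
    rw [norm_mul, hu, mul_one, Complex.norm_real, Real.norm_eq_abs, abs_of_nonneg (by linarith)]
  have h3 : 1 - r ≤ ‖1 + r * u‖ := by
    have := norm_sub_norm_le (1 : ℂ) (-(r * u))
    rw [sub_neg_eq_add, norm_neg, norm_mul, hu, mul_one, norm_one, Complex.norm_real,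
      Real.norm_eq_abs, abs_of_nonneg hr0] at this
    exact this
  linarith

lemma half_add_I_mul_ne_zero (y : ℝ) : (1 / 2 + I * y : ℂ) ≠ 0 := fun h => by
  have := congrArg Complex.re h
  simp at this

lemma discZetaInv_toCircle_cayleyAngle {σ : ℝ} (hσ : σ < 1) (y : ℝ) :
    discZetaInv σ (toCircle (cayleyAngle y)) = recipZeta σ y := by
  have h1 : ((σ : ℂ) + I * y) ≠ 1 := fun h => by
    have := congrArg Complex.re h
    simp at this
    exact hσ.ne this
  rw [discZetaInv, one_add_toCircle_cayleyAngle, inv_inv, recipZeta, ← zetaInv_eq h1]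
  congr 1
  ring

lemma ae_one_add_toCircle_ne_zero :
    ∀ᵐ t ∂haarAddCircle (T := 2 * Real.pi), 1 + (toCircle t : ℂ) ≠ 0 := by
  have hc : Continuous fun t : AddCircle (2 * Real.pi) => 1 + (toCircle t : ℂ) :=
    continuous_const.add (continuous_induced_dom.comp continuous_toCircle)
  rw [← measurePreserving_cayleyAngle.map_eq]
  refine (ae_map_iff (p := fun t => 1 + (toCircle t : ℂ) ≠ 0)
    measurePreserving_cayleyAngle.measurable.aemeasurable
    (isOpen_compl_singleton.preimage hc).measurableSet).2 (.of_forall fun y => ?_)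
  rw [one_add_toCircle_cayleyAngle]
  exact inv_ne_zero (half_add_I_mul_ne_zero y)

/-- The square grows like `|y|^{1/2}` against a density decaying like `y^{-2}`, leaving the
integrable `|y|^{-3/2}`. -/
lemma memLp_norm_half_add_I_mul_rpow :
    MemLp (fun y : ℝ => ‖(1 / 2 + I * y : ℂ)‖ ^ (1 / 4 : ℝ)) 2 muMeasure := by
  have hc : Continuous fun y : ℝ => ‖(1 / 2 + I * y : ℂ)‖ ^ (1 / 4 : ℝ) :=
    (by fun_prop : Continuous fun y : ℝ => ‖(1 / 2 + I * y : ℂ)‖).rpow_const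
      fun _ => .inr (by norm_num)
  rw [memLp_two_iff_integrable_sq hc.aestronglyMeasurable, muMeasure,
    integrable_withDensity_iff_integrable_smul' (by fun_prop)
      (.of_forall fun _ => ENNReal.ofReal_lt_top)]
  have hi : Integrable fun y : ℝ => (1 + ‖2 * y‖ ^ 2) ^ (-(3 / 2 : ℝ) / 2) :=
    (integrable_rpow_neg_one_add_norm_sq (E := ℝ) (μ := volume) (r := 3 / 2)
      (by rw [Module.finrank_self]; norm_num)).comp_mul_left' two_ne_zero
  refine (hi.const_mul (1 / (2 * Real.pi) * (1 / 4 : ℝ) ^ (-(3 / 4) : ℝ))).congr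
    (.of_forall fun y => ?_)
  have hpos : (0 : ℝ) < 1 / 4 + y ^ 2 := by positivity
  have hn : ‖(1 / 2 + I * y : ℂ)‖ = (1 / 4 + y ^ 2) ^ (1 / 2 : ℝ) := by
    rw [← Real.sqrt_eq_rpow, Complex.norm_def, Complex.normSq_apply]
    congr 1
    simp
    ring
  have e1 : (1 + ‖2 * y‖ ^ 2 : ℝ) = 4 * (1 / 4 + y ^ 2) := by
    rw [Real.norm_eq_abs, sq_abs]; ring
  dsimp only
  rw [ENNReal.toReal_ofReal (by positivity), hn, e1, Real.mul_rpow (by norm_num) hpos.le,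
    ← Real.rpow_mul hpos.le, ← Real.rpow_mul_natCast hpos.le, smul_eq_mul,
    one_div (1 / 4 + y ^ 2), mul_assoc, mul_assoc, ← Real.rpow_neg_one (1 / 4 + y ^ 2),
    ← Real.rpow_add hpos, ← mul_assoc ((1 / 4 : ℝ) ^ _)]
  have e2 : (1 / 4 : ℝ) ^ (-(3 / 4) : ℝ) * 4 ^ (-(3 / 2 : ℝ) / 2) = 1 := by
    rw [show -(3 / 2 : ℝ) / 2 = -(3 / 4) by norm_num,
      ← Real.mul_rpow (by norm_num) (by norm_num)]
    norm_num
  rw [e2, one_mul]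
  norm_num

/-- The dominating function `‖1 + e^{it}‖ ^ (-1/4)` on the circle. -/
noncomputable def circleMajorant (t : AddCircle (2 * Real.pi)) : ℝ :=
  (‖1 + (toCircle t : ℂ)‖⁻¹) ^ (1 / 4 : ℝ)

lemma memLp_circleMajorant : MemLp circleMajorant 2 haarAddCircle := by
  have hc : Continuous fun t : AddCircle (2 * Real.pi) => ‖1 + (toCircle t : ℂ)‖ :=
    (continuous_const.add (continuous_induced_dom.comp continuous_toCircle)).norm
  have hm : Measurable circleMajorant := hc.measurable.inv.pow_const _
  rw [← measurePreserving_cayleyAngle.map_eq, memLp_map_measure_iff hm.aestronglyMeasurable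
    measurePreserving_cayleyAngle.measurable.aemeasurable]
  convert memLp_norm_half_add_I_mul_rpow using 2 with y
  simp only [Function.comp, circleMajorant]
  rw [one_add_toCircle_cayleyAngle, norm_inv, inv_inv]

lemma fourierCoeff_toCircle_eq_fourierCoeffMu {H : ℂ → ℂ}
    (hH : Measurable H) (n : ℤ) :
    fourierCoeff (fun t : AddCircle (2 * Real.pi) => H (toCircle t)) n =
      fourierCoeffMu (fun y => H (toCircle (cayleyAngle y))) n := by
  have hc : Measurable fun t : AddCircle (2 * Real.pi) => (toCircle t : ℂ) :=
    (continuous_induced_dom.comp continuous_toCircle).measurable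
  refine (integral_haarAddCircle_eq_integral_muMeasure
    (((fourier (-n)).continuous.measurable.smul (hH.comp hc)).aestronglyMeasurable)).trans
    (integral_congr_ae (.of_forall fun y => ?_))
  have h : fourier (-n) (cayleyAngle y) =
      cexp (2 * I * (n : ℂ) * (Real.arctan (2 * y) : ℂ)) := by
    rw [fourier_apply, toCircle_zsmul, Circle.coe_zpow, toCircle_cayleyAngle, ← Complex.exp_int_mul]
    congr 1
    push_cast
    ring
  change fourier (-n) (cayleyAngle y) * H (toCircle (cayleyAngle y)) = _
  rw [h, mul_comm]

end ZetaInv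

/-! ### Identification of `ā_n` and conclusion -/

section Main
open Set Filter Topology Complex Metric AddCircle

lemma RiemannHypothesis.abar_eq (hRH : RiemannHypothesis) {σ : ℝ} (hσ : 1 / 2 < σ) (n : ℕ) :
    abar σ (n + 1) = iteratedDeriv (n + 1) (discZetaInv σ) 0 / (n + 1).factorial := by
  set G : ℂ → ℂ := fun s => zetaInv ((σ : ℂ) + 1 / 2 - s) with hG
  have hU : IsOpen {s : ℂ | s.re < σ} := isOpen_lt Complex.continuous_re continuous_const
  have hGa : AnalyticOnNhd ℂ G {s : ℂ | s.re < σ} := by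
    refine DifferentiableOn.analyticOnNhd (fun s hs => DifferentiableAt.differentiableWithinAt ?_) hU
    refine DifferentiableAt.comp (g := zetaInv) s (hRH.differentiableAt_zetaInv ?_) (by fun_prop)
    have : s.re < σ := hs
    simp only [sub_re, add_re, ofReal_re, one_re, div_ofNat_re]
    linarith
  have h := iteratedDeriv_comp_div_one_add hGa (isOpen_ball (x := (0 : ℂ)) (ε := 1))
    (fun u hu => one_add_ne_zero_of_norm_lt_one (by simpa using hu))
    (fun u hu => by
      have hu' : ‖u‖ < 1 := by simpa using hu
      have := half_le_re_inv_one_add hu'.le (one_add_ne_zero_of_norm_lt_one hu')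
      simp only [mem_ofPred_eq, sub_re, one_re]
      linarith) (n + 1) 0 (by simp)
  have hdisc : discZetaInv σ = fun u => G (1 - (1 + u)⁻¹) := rfl
  have hev : G =ᶠ[𝓝 0] fun s : ℂ => 1 / riemannZeta ((σ : ℂ) + 1 / 2 - s) := by
    have hc : Continuous fun s : ℂ => (σ : ℂ) + 1 / 2 - s := by fun_prop
    have h1 : (σ : ℂ) + 1 / 2 - 0 ≠ 1 := fun h => by
      have := congrArg Complex.re h
      simp at this
      linarith
    filter_upwards [hc.continuousAt.eventually_ne h1] with s hs using zetaInv_eq hs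
  -- At `u = 0` all powers of `1/(1+u)` are 1; the `k = 0` term drops as the order is positive.
  rw [hdisc, h, abar, Finset.sum_range_succ', signedLah_succ_zero, zero_mul, add_zero,
    one_div_mul_eq_div]
  congr 1
  symm
  refine Finset.sum_nbij (fun k => k + 1) (fun k hk => ?_) (fun a _ b _ hab => by simpa using hab)
    (fun k hk => ?_) (fun k hk => ?_)
  · simp only [Finset.mem_range, Finset.mem_Icc] at hk ⊢
    omega
  · simp only [Finset.coe_Icc, Finset.coe_range, mem_image, mem_Iio, mem_Icc] at hk ⊢
    exact ⟨k - 1, by omega, by omega⟩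
  · have hk' : k ≤ n := Nat.lt_succ_iff.1 (Finset.mem_range.1 hk)
    have hs : (-1 : ℂ) ^ (n + k) = (-1) ^ (n - k) := by
      rw [show n + k = (n - k) + 2 * k by omega, pow_add, pow_mul]
      simp
    have h0 : (1 : ℂ) - (1 + 0)⁻¹ = 0 := by norm_num
    rw [signedLah_succ_succ, hs, h0, hev.iteratedDeriv_eq (k + 1)]
    simp only [Nat.add_sub_add_right, Nat.add_sub_cancel, add_zero, inv_one, one_pow, mul_one]
    ring

theorem corollary1p1p1 (hRH : RiemannHypothesis) (σ : ℝ) (hσ : 1 / 2 < σ) (hσ' : σ < 1) :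
    MemLp (recipZeta σ) 2 muMeasure ∧
    (∀ n : ℕ, 1 ≤ n → abar σ n = fourierCoeffMu (recipZeta σ) (n : ℤ)) ∧
    Summable (fun k : ℕ => ‖abar σ (k + 1)‖ ^ 2) ∧
    ((∫ y : ℝ, 1 / ‖riemannZeta ((σ : ℂ) + Complex.I * (y : ℂ))‖ ^ 2 ∂muMeasure : ℝ) : ℂ) =
      1 / riemannZeta ((σ : ℂ) + 1 / 2) ^ 2 +
        ((∑' k : ℕ, ‖abar σ (k + 1)‖ ^ 2 : ℝ) : ℂ) := by
  set H : ℂ → ℂ := discZetaInv σ with hHdef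
  have hHd : DifferentiableOn ℂ H (ball 0 1) := fun u hu => by
    have hu' : ‖u‖ < 1 := by simpa using hu
    exact (hRH.differentiableAt_discZetaInv hσ hu'.le
      (one_add_ne_zero_of_norm_lt_one hu')).differentiableWithinAt
  have hHm : Measurable H :=
    measurable_zetaInv.comp (measurable_const.sub
      (measurable_const.sub (measurable_const.add measurable_id).inv))
  have hrec : (fun y => H (toCircle (cayleyAngle y))) = recipZeta σ :=
    funext fun y => discZetaInv_toCircle_cayleyAngle hσ' y
  obtain ⟨C, hC0, hC⟩ := hRH.exists_norm_discZetaInv_le hσ hσ'.le (show (0 : ℝ) < 1 / 4 by norm_num)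
  -- The case `r = 1` is included because it gives the L² bound on the boundary.
  have hdom : ∀ r : ℝ, 0 < r → r ≤ 1 → ∀ᵐ t ∂haarAddCircle (T := 2 * Real.pi),
      ‖H (r * (toCircle t : ℂ))‖ ≤ C * 2 ^ (1 / 4 : ℝ) * circleMajorant t := by
    intro r hr0 hr1
    filter_upwards [ae_one_add_toCircle_ne_zero] with t ht
    have hpos := norm_pos_iff.2 ht
    have h2 := norm_one_add_le_two_mul (Circle.norm_coe (toCircle t)) hr0.le hr1
    have hpos' : 0 < ‖1 + r * (toCircle t : ℂ)‖ := by linarith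
    refine (hC _ ?_ (norm_pos_iff.1 hpos')).trans ?_
    · rw [norm_mul, Circle.norm_coe, mul_one, Complex.norm_real, Real.norm_eq_abs,
        abs_of_pos hr0]
      exact hr1
    · rw [circleMajorant, mul_assoc, ← Real.mul_rpow (by norm_num) (by positivity)]
      gcongr
      rw [← div_eq_mul_inv, inv_le_comm₀ hpos' (by positivity), inv_div, div_le_iff₀ two_pos]
      linarith
  have hG2 : MemLp (fun t => C * 2 ^ (1 / 4 : ℝ) * circleMajorant t) 2 haarAddCircle :=
    memLp_circleMajorant.const_mul _
  have hG : Integrable (fun t => C * 2 ^ (1 / 4 : ℝ) * circleMajorant t) haarAddCircle :=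
    hG2.integrable one_le_two
  have hbound : ∀ r : ℝ, 0 < r → r < 1 → ∀ᵐ t ∂haarAddCircle (T := 2 * Real.pi),
      ‖H (r * (toCircle t : ℂ))‖ ≤ C * 2 ^ (1 / 4 : ℝ) * circleMajorant t :=
    fun r hr0 hr1 => hdom r hr0 hr1.le
  have hlim : ∀ᵐ t ∂haarAddCircle (T := 2 * Real.pi),
      Tendsto (fun r : ℝ => H (r * (toCircle t : ℂ))) (𝓝[<] 1) (𝓝 (H (toCircle t))) := by
    filter_upwards [ae_one_add_toCircle_ne_zero] with t ht
    have h1 := (hRH.differentiableAt_discZetaInv hσ (Circle.norm_coe (toCircle t)).le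
      ht).continuousAt
    have h2 : Tendsto (fun r : ℝ => (r : ℂ) * (toCircle t : ℂ)) (𝓝[<] 1) (𝓝 (toCircle t : ℂ)) := by
      have : Continuous fun r : ℝ => (r : ℂ) * (toCircle t : ℂ) := by fun_prop
      simpa using (this.tendsto 1).mono_left nhdsWithin_le_nhds
    exact h1.tendsto.comp h2
  have hc : Measurable fun t : AddCircle (2 * Real.pi) => (toCircle t : ℂ) :=
    (continuous_induced_dom.comp continuous_toCircle).measurable
  have hL2 : MemLp (fun t : AddCircle (2 * Real.pi) => H (toCircle t)) 2 haarAddCircle := by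
    refine hG2.mono' (hHm.comp hc).aestronglyMeasurable ?_
    filter_upwards [hdom 1 one_pos le_rfl] with t ht
    simpa using ht
  have hcoeff : ∀ n : ℕ, abar σ (n + 1) = fourierCoeffMu (recipZeta σ) ((n + 1 : ℕ) : ℤ) := by
    intro n
    rw [hRH.abar_eq hσ, ← (fourierCoeff_boundary hHd hG hbound hlim).1,
      fourierCoeff_toCircle_eq_fourierCoeffMu hHm, hrec]
  have hsum := (hasSum_sq_norm_iteratedDeriv hHd hG hbound hlim hL2)
  -- Splits off the term `‖H 0‖²`.
  have hsum' := (hasSum_nat_add_iff' 1).2 hsum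
  simp only [hHdef, ← hRH.abar_eq hσ] at hsum'
  have hint : ∫ t : AddCircle (2 * Real.pi), ‖H (toCircle t)‖ ^ 2 ∂haarAddCircle =
      ∫ y : ℝ, 1 / ‖riemannZeta ((σ : ℂ) + I * (y : ℂ))‖ ^ 2 ∂muMeasure := by
    refine (integral_haarAddCircle_eq_integral_muMeasure
      ((hHm.comp hc).norm.pow_const 2).aestronglyMeasurable).trans
      (integral_congr_ae (.of_forall fun y => ?_))
    change ‖discZetaInv σ (toCircle (cayleyAngle y))‖ ^ 2 = _
    rw [discZetaInv_toCircle_cayleyAngle hσ', recipZeta, norm_div, norm_one, div_pow, one_pow]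
  have hx : (1 : ℝ) < σ + 1 / 2 := by linarith
  have hcast : ((σ : ℂ) + 1 / 2) = ((σ + 1 / 2 : ℝ) : ℂ) := by push_cast; ring
  have hne : ((σ : ℂ) + 1 / 2) ≠ 1 := by
    rw [hcast]; exact_mod_cast hx.ne'
  have hH0 : H 0 = 1 / riemannZeta ((σ : ℂ) + 1 / 2) := by
    rw [← zetaInv_eq hne, hHdef, discZetaInv]; simp
  -- `ζ` is real at real points beyond 1, so the squared modulus is a plain square.
  have hreal : ((‖H 0‖ ^ 2 : ℝ) : ℂ) = 1 / riemannZeta ((σ : ℂ) + 1 / 2) ^ 2 := by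
    have hre : riemannZeta ((σ : ℂ) + 1 / 2) =
        ((riemannZeta ((σ : ℂ) + 1 / 2)).re : ℂ) := by
      refine Complex.ext rfl ?_
      rw [hcast, riemannZeta_im_eq_zero_of_one_lt hx, ofReal_im]
    rw [hH0, hre]
    generalize (riemannZeta ((σ : ℂ) + 1 / 2)).re = x
    rw [norm_div, norm_one, Complex.norm_real, div_pow, one_pow, Real.norm_eq_abs, sq_abs]
    push_cast
    rfl
  refine ⟨?_, ?_, hsum'.summable, ?_⟩
  · rw [← hrec]
    exact hL2.comp_measurePreserving measurePreserving_cayleyAngle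
  · intro n hn
    obtain ⟨m, rfl⟩ := Nat.exists_eq_succ_of_ne_zero (Nat.one_le_iff_ne_zero.1 hn)
    exact hcoeff m
  · rw [hsum'.tsum_eq, ← hreal, ← hint]
    simp [hHdef]

end Main
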